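/- Write $M_2(\mathbb{C})$ for the complex $2\times 2$ matrices. A linear map $T:M_2(\mathbb{C})\to M_2(\mathbb{C})$ is completely positive if $T\otimes\mathrm{id}$ maps positive semidefinite matrices in $M_2(\mathbb{C})\otimes M_2(\mathbb{C})\cong M_4(\mathbb{C})$ to positive semidefinite matrices; it is trace-preserving if $\mathrm{tr}\,T(X)=\mathrm{tr}\,X$ for all $X$, and unital if $T(\mathbb{1})=\mathbb{1}$. Let $\mathrm{spec}(T)$ be the multiset of the four eigenvalues of $T$ as a linear operator on the four-dimensional complex vector space $M_2(\mathbb{C})$, each counted with its algebraic multiplicity (the roots of the characteristic polynomial of $T$). Let $\mathcal{T}\subset\mathbb{R}^3$ be the tetrahedron, i.e. the convex hull, with vertices $(1,1,1)$, $(1,-1,-1)$, $(-1,1,-1)$, $(-1,-1,1)$. Theorem (Spectra of qubit channels). For a multiset $\Lambda$ of four complex numbers the following statements are equivalent. (1) There is a trace-preserving completely positive linear map $T:M_2(\mathbb{C})\to M_2(\mathbb{C})$ with $\mathrm{spec}(T)=\Lambda$. (2) There is a unital and trace-preserving completely positive linear map $T:M_2(\mathbb{C})\to M_2(\mathbb{C})$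 with $\mathrm{spec}(T)=\Lambda$. (3) There is $\lambda=(\lambda_1,\lambda_2,\lambda_3)\in\mathbb{C}^3$ such that $\Lambda=\{1,\lambda_1,\lambda_2,\lambda_3\}$ as multisets, the multiset $\{\lambda_1,\lambda_2,\lambda_3\}$ is invariant under complex conjugation (with multiplicities), and the vector $s\in\mathbb{R}^3$ defined by $s_i:=\lambda_i$ if $\lambda_i\in\mathbb{R}$ and $s_i:=|\lambda_i|$ otherwise satisfies $s\in\mathcal{T}$. -/

import Mathlib

open scoped ComplexOrder ComplexConjugate Kronecker

noncomputable section

namespace QubitSpectrum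

/-- A linear map on square matrices is positive if it maps positive semidefinite matrices to
positive semidefinite matrices. -/
def IsPositiveMap {n : Type*} (T : Matrix n n ℂ →ₗ[ℂ] Matrix n n ℂ) : Prop :=
  ∀ X : Matrix n n ℂ, X.PosSemidef → (T X).PosSemidef

/-- The map `T ⊗ id` on `M_n(ℂ) ⊗ M_k(ℂ)`, the latter realised as matrices indexed by `n × k`
(so that `A ⊗ B` is the Kronecker product): `T` is applied to each of the `k × k` many
`n × n` blocks. -/
def tensorId {n : Type*} (k : Type*) (T : Matrix n n ℂ →ₗ[ℂ] Matrix n n ℂ) :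
    Matrix (n × k) (n × k) ℂ →ₗ[ℂ] Matrix (n × k) (n × k) ℂ where
  toFun X := Matrix.of fun p q => T (Matrix.of fun a b => X (a, p.2) (b, q.2)) p.1 q.1
  map_add' X Y := by
    ext p q
    exact congrFun (congrFun (map_add T (Matrix.of fun a b => X (a, p.2) (b, q.2))
      (Matrix.of fun a b => Y (a, p.2) (b, q.2))) p.1) q.1
  map_smul' c X := by
    ext p q
    exact congrFun (congrFun (map_smul T c (Matrix.of fun a b => X (a, p.2) (b, q.2))) p.1) q.1

/-- `tensorId k T` acts as `T ⊗ id` on product matrices. -/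
theorem tensorId_kronecker {n k : Type*} (T : Matrix n n ℂ →ₗ[ℂ] Matrix n n ℂ)
    (A : Matrix n n ℂ) (B : Matrix k k ℂ) : tensorId k T (A ⊗ₖ B) = T A ⊗ₖ B := by
  ext p q
  have h : (Matrix.of fun a b => (A ⊗ₖ B) (a, p.2) (b, q.2)) = B p.2 q.2 • A := by
    ext a b
    simp [mul_comm]
  change T (Matrix.of fun a b => (A ⊗ₖ B) (a, p.2) (b, q.2)) p.1 q.1 = _
  rw [h, map_smul]
  simp [mul_comm]

/-- A linear map on `M_d(ℂ)` is completely positive if `T ⊗ id_d` is positive. -/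
def IsCompletelyPositive {d : ℕ}
    (T : Matrix (Fin d) (Fin d) ℂ →ₗ[ℂ] Matrix (Fin d) (Fin d) ℂ) : Prop :=
  IsPositiveMap (tensorId (Fin d) T)

/-- A linear map on `M_d(ℂ)` is trace-preserving. -/
def IsTracePreserving {d : ℕ}
    (T : Matrix (Fin d) (Fin d) ℂ →ₗ[ℂ] Matrix (Fin d) (Fin d) ℂ) : Prop :=
  ∀ X : Matrix (Fin d) (Fin d) ℂ, (T X).trace = X.trace

/-- A quantum channel: a completely positive and trace-preserving linear map. -/
def IsQuantumChannel {d : ℕ}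
    (T : Matrix (Fin d) (Fin d) ℂ →ₗ[ℂ] Matrix (Fin d) (Fin d) ℂ) : Prop :=
  IsCompletelyPositive T ∧ IsTracePreserving T

/-- A linear map on `M_d(ℂ)` is unital if it fixes the identity matrix. -/
def IsUnital {d : ℕ}
    (T : Matrix (Fin d) (Fin d) ℂ →ₗ[ℂ] Matrix (Fin d) (Fin d) ℂ) : Prop :=
  T 1 = 1

/-- The spectrum as a multiset: the roots of the characteristic polynomial, so each eigenvalue
appears with its algebraic multiplicity. -/
def spec {d : ℕ} (T : Matrix (Fin d) (Fin d) ℂ →ₗ[ℂ] Matrix (Fin d) (Fin d) ℂ) : Multiset ℂ :=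
  T.charpoly.roots

/-- The tetrahedron whose corners are the vectors with entries `±1` of product `1`. -/
def tetrahedron : Set (Fin 3 → ℝ) :=
  convexHull ℝ {![1, 1, 1], ![1, -1, -1], ![-1, 1, -1], ![-1, -1, 1]}

/-- `z` itself if `z` is real, and `|z|` otherwise. -/
def realOrAbs (z : ℂ) : ℝ := if z.im = 0 then z.re else ‖z‖

end QubitSpectrum

end

namespace QubitSpectrum

open Matrix Polynomial

/-! A channel preserves the real three-dimensional space of traceless Hermitian matrices. Odd
dimension gives a real eigenvalue `r` there, and a unitary change of basis turns the eigenvector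
into a multiple of `diag(1, -1)`. The channel is then block triangular with diagonal blocks `r`,
`!![α, β̄; β, ᾱ]` and `1`, and two principal minors of its Choi matrix bound `α` and `β`. This data,
`HasNormalForm`, is the hub: `IsQuantumChannel.hasNormalForm` extracts it from a channel, elementary
algebra matches it with the tetrahedron in both directions, and `normalFormMap` realises it by a
unital channel with explicit Kraus operators. -/

theorem exists_isRoot_of_odd_natDegree {P : ℝ[X]} (hP : P.Monic) (hodd : Odd P.natDegree) :
    ∃ x, P.IsRoot x := by
  by_contra! h
  -- Without roots, `0` lies vacuously both above and below all of them, so `P(0)` gets both signs.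
  have h1 := zero_lt_eval_of_roots_lt_of_leadingCoeff_nonneg (P := P) (x := 0)
    (fun y hy => absurd hy (h y)) (by simp [hP.leadingCoeff])
  have h2 := zero_lt_negOnePow_mul_eval_of_lt_roots_of_leadingCoeff_nonneg (P := P) (x := 0)
    (fun y hy => absurd hy (h y)) (by simp [hP.leadingCoeff])
  rw [Int.negOnePow_odd _ (by exact_mod_cast hodd)] at h2
  push_cast at h2
  linarith

/-! ### Complete positivity and the Choi matrix -/

/-- The map `X ↦ K X Kᴴ`. -/
def conjMap {n : Type*} [Fintype n] (K : Matrix n n ℂ) : Matrix n n ℂ →ₗ[ℂ] Matrix n n ℂ where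
  toFun X := K * X * Kᴴ
  map_add' X Y := by rw [mul_add, add_mul]
  map_smul' c X := by simp

@[simp]
theorem conjMap_apply {n : Type*} [Fintype n] (K X : Matrix n n ℂ) :
    conjMap K X = K * X * Kᴴ := rfl

theorem tensorId_conjMap {n k : Type*} [Fintype n] [Fintype k] [DecidableEq k]
    (K : Matrix n n ℂ) : tensorId k (conjMap K) = conjMap (K ⊗ₖ (1 : Matrix k k ℂ)) := by
  ext1 X
  ext ⟨a, i⟩ ⟨b, j⟩
  simp [tensorId, Matrix.mul_apply, Fintype.sum_prod_type, Matrix.one_apply, Finset.sum_mul,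
    apply_ite conj]

theorem tensorId_comp {n : Type*} (k : Type*) (S T : Matrix n n ℂ →ₗ[ℂ] Matrix n n ℂ) :
    tensorId k (S ∘ₗ T) = tensorId k S ∘ₗ tensorId k T := rfl

theorem tensorId_add {n : Type*} (k : Type*) (S T : Matrix n n ℂ →ₗ[ℂ] Matrix n n ℂ) :
    tensorId k (S + T) = tensorId k S + tensorId k T := rfl

section

variable {d : ℕ} {S T : Matrix (Fin d) (Fin d) ℂ →ₗ[ℂ] Matrix (Fin d) (Fin d) ℂ}

theorem isCompletelyPositive_conjMap (K : Matrix (Fin d) (Fin d) ℂ) :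
    IsCompletelyPositive (conjMap K) := by
  intro X hX
  rw [tensorId_conjMap]
  exact hX.mul_mul_conjTranspose_same _

theorem IsCompletelyPositive.comp (hS : IsCompletelyPositive S) (hT : IsCompletelyPositive T) :
    IsCompletelyPositive (S ∘ₗ T) := fun X hX => by
  rw [tensorId_comp]
  exact hS _ (hT X hX)

theorem IsCompletelyPositive.add (hS : IsCompletelyPositive S) (hT : IsCompletelyPositive T) :
    IsCompletelyPositive (S + T) := fun X hX => by
  rw [tensorId_add]
  exact (hS X hX).add (hT X hX)

/-- The Choi matrix is the image under `T ⊗ id` of the unnormalised maximally entangled projector.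
-/
theorem IsCompletelyPositive.choi_posSemidef (hT : IsCompletelyPositive T) :
    (Matrix.of fun p q : Fin d × Fin d => T (single p.2 q.2 1) p.1 q.1).PosSemidef := by
  convert hT _ (posSemidef_vecMulVec_self_star
    (fun p : Fin d × Fin d => if p.1 = p.2 then (1 : ℂ) else 0)) using 1
  ext p q
  simp only [tensorId, LinearMap.coe_mk, AddHom.coe_mk, of_apply]
  refine congrFun (congrFun (congrArg T ?_) p.1) q.1
  ext a b
  simp only [vecMulVec_apply, single_apply, of_apply, Pi.star_apply]
  split_ifs <;> simp_all

theorem IsCompletelyPositive.star_apply_single (hT : IsCompletelyPositive T) (i j k l : Fin d) :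
    conj (T (single i j 1) k l) = T (single j i 1) l k :=
  hT.choi_posSemidef.isHermitian.apply (l, j) (k, i)

theorem IsCompletelyPositive.map_isHermitian (hT : IsCompletelyPositive T)
    {X : Matrix (Fin d) (Fin d) ℂ} (hX : X.IsHermitian) : (T X).IsHermitian := by
  have key (Y : Matrix (Fin d) (Fin d) ℂ) : (T Y)ᴴ = T Yᴴ := by
    induction Y using Matrix.induction_on' with
    | h_zero => simp
    | h_add p q hp hq => simp [hp, hq]
    | h_std_basis i j x =>
      have h (a b : Fin d) (y : ℂ) : single a b y = y • single a b (1 : ℂ) := by simp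
      rw [conjTranspose_single, h i j, h j i, map_smul, map_smul, conjTranspose_smul]
      congr 1
      ext k l
      exact hT.star_apply_single i j l k
  rw [IsHermitian, key, hX]

end

/-- The determinant bounds the off-diagonal entry by the geometric mean of the diagonal; AM-GM does
the rest. -/
theorem two_mul_norm_le_of_posSemidef {M : Matrix (Fin 2) (Fin 2) ℂ} (hM : M.PosSemidef) :
    2 * ‖M 0 1‖ ≤ (M 0 0).re + (M 1 1).re := by
  have h0 := Complex.nonneg_iff.1 (hM.diag_nonneg (i := 0))
  have h1 := Complex.nonneg_iff.1 (hM.diag_nonneg (i := 1))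
  have hd := (Complex.nonneg_iff.1 hM.det_nonneg).1
  have h10 : M 1 0 = conj (M 0 1) := (hM.isHermitian.apply 1 0).symm
  rw [det_fin_two, h10, Complex.mul_conj'] at hd
  have h2 : ‖M 0 1‖ ^ 2 ≤ (M 0 0).re * (M 1 1).re := by
    have : ((‖M 0 1‖ : ℂ) ^ 2).re = ‖M 0 1‖ ^ 2 := by norm_cast
    rw [Complex.sub_re, Complex.mul_re, this, ← h0.2, ← h1.2] at hd
    linarith
  refine abs_le_of_sq_le_sq' ?_ (by linarith) |>.2
  nlinarith [sq_nonneg ((M 0 0).re - (M 1 1).re)]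

/-! ### Pauli coordinates and a traceless Hermitian eigenvector -/

/-- The Hermitian traceless matrix with given coordinates in the Pauli basis. -/
def pauli : (Fin 3 → ℝ) →ₗ[ℝ] Matrix (Fin 2) (Fin 2) ℂ where
  toFun n := !![(n 2 : ℂ), n 0 - n 1 * Complex.I; n 0 + n 1 * Complex.I, -n 2]
  map_add' m n := by
    ext i j; fin_cases i <;> fin_cases j <;> simp <;> ring
  map_smul' c n := by
    ext i j; fin_cases i <;> fin_cases j <;> simp <;> ring

theorem pauli_apply (n : Fin 3 → ℝ) :
    pauli n = !![(n 2 : ℂ), n 0 - n 1 * Complex.I; n 0 + n 1 * Complex.I, -n 2] := rfl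

/-- The coordinates of a Hermitian traceless matrix in the Pauli basis. -/
def pauliCoord : Matrix (Fin 2) (Fin 2) ℂ →ₗ[ℝ] (Fin 3 → ℝ) where
  toFun X := ![(X 1 0).re, (X 1 0).im, (X 0 0).re]
  map_add' X Y := by ext i; fin_cases i <;> simp
  map_smul' c X := by ext i; fin_cases i <;> simp

theorem isHermitian_pauli (n : Fin 3 → ℝ) : (pauli n).IsHermitian := by
  ext i j
  fin_cases i <;> fin_cases j <;> simp [pauli_apply, sub_eq_add_neg]

theorem trace_pauli (n : Fin 3 → ℝ) : (pauli n).trace = 0 := by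
  simp [pauli_apply, trace_fin_two]

theorem pauli_pauliCoord {X : Matrix (Fin 2) (Fin 2) ℂ} (hX : X.IsHermitian)
    (h0 : X.trace = 0) : pauli (pauliCoord X) = X := by
  have h00 := Complex.conj_eq_iff_real.1 (hX.apply 0 0)
  have h10 : X 0 1 = conj (X 1 0) := (hX.apply 0 1).symm
  have h11 : X 1 1 = - X 0 0 := by rw [trace_fin_two] at h0; linear_combination h0
  obtain ⟨x, hx⟩ := h00
  ext i j
  fin_cases i <;> fin_cases j <;>
    simp [pauli_apply, pauliCoord, h10, h11, hx] <;> apply Complex.ext <;> simp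

theorem pauli_injective : Function.Injective pauli := by
  refine Function.LeftInverse.injective (g := pauliCoord) fun n => ?_
  ext i
  fin_cases i <;> simp [pauli_apply, pauliCoord]

theorem exists_traceless_eigenvector
    {T : Matrix (Fin 2) (Fin 2) ℂ →ₗ[ℂ] Matrix (Fin 2) (Fin 2) ℂ} (hT : IsQuantumChannel T) :
    ∃ (r : ℝ) (H : Matrix (Fin 2) (Fin 2) ℂ),
      H.IsHermitian ∧ H.trace = 0 ∧ H ≠ 0 ∧ T H = (r : ℂ) • H := by
  let L : Module.End ℝ (Fin 3 → ℝ) := pauliCoord ∘ₗ T.restrictScalars ℝ ∘ₗ pauli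
  obtain ⟨r, hr⟩ := exists_isRoot_of_odd_natDegree L.charpoly_monic
    (by rw [LinearMap.charpoly_natDegree]; simp; exact ⟨1, rfl⟩)
  obtain ⟨n, hn⟩ := ((Module.End.hasEigenvalue_iff_isRoot_charpoly L r).2 hr).exists_hasEigenvector
  refine ⟨r, pauli n, isHermitian_pauli n, trace_pauli n,
    fun h => hn.2 (pauli_injective (by simpa using h)), ?_⟩
  have := congrArg pauli hn.apply_eq_smul
  rw [map_smul] at this
  simp only [L, LinearMap.comp_apply, LinearMap.restrictScalars_apply] at this
  rw [pauli_pauliCoord (hT.1.map_isHermitian (isHermitian_pauli n))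
    (by rw [hT.2, trace_pauli])] at this
  rw [this]
  ext i j
  simp

/-- A Hermitian traceless matrix is unitarily equivalent to a multiple of `diag(1, -1)`. -/
theorem exists_unitary_diagonalization {H : Matrix (Fin 2) (Fin 2) ℂ} (hH : H.IsHermitian)
    (h0 : H.trace = 0) :
    ∃ (U : Matrix (Fin 2) (Fin 2) ℂ) (c : ℂ), Uᴴ * U = 1 ∧ U * Uᴴ = 1 ∧
      H = U * (c • !![1, 0; 0, -1]) * Uᴴ := by
  refine ⟨hH.eigenvectorUnitary, hH.eigenvalues 0, ?_, ?_, ?_⟩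
  · exact Unitary.coe_star_mul_self _
  · exact Unitary.coe_mul_star_self _
  · have ht := hH.trace_eq_sum_eigenvalues
    rw [h0, Fin.sum_univ_two] at ht
    conv_lhs => rw [hH.spectral_theorem, Unitary.conjStarAlgAut_apply]
    congr 2
    ext i j
    fin_cases i <;> fin_cases j <;> simp
    simp at ht
    linear_combination -ht

/-! ### Normal form versus tetrahedron -/

/-- The multisets `{1, r, z, w}` in which `z`, `w` are the eigenvalues of `!![α, β; β̄, ᾱ]`
and the bounds on `α`, `β` are those that make the corresponding map completely positive. -/
def HasNormalForm (Λ : Multiset ℂ) : Prop :=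
  ∃ (r : ℝ) (α β z w : ℂ), 2 * ‖α‖ ≤ 1 + r ∧ 2 * ‖β‖ ≤ 1 - r ∧ z + w = α + conj α ∧
    z * w = α * conj α - β * conj β ∧ Λ = {1, (r : ℂ), z, w}

theorem mem_tetrahedron_iff (s : Fin 3 → ℝ) :
    s ∈ tetrahedron ↔ |s 1 + s 2| ≤ 1 + s 0 ∧ |s 1 - s 2| ≤ 1 - s 0 := by
  constructor
  · intro hs
    have hc : Convex ℝ {s : Fin 3 → ℝ | |s 1 + s 2| ≤ 1 + s 0 ∧ |s 1 - s 2| ≤ 1 - s 0} := by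
      intro x hx y hy a b ha hb hab
      simp only [Set.mem_ofPred_eq, abs_le, Pi.add_apply, Pi.smul_apply, smul_eq_mul] at hx hy ⊢
      obtain rfl : b = 1 - a := by linarith
      refine ⟨⟨?_, ?_⟩, ?_, ?_⟩ <;> nlinarith
    refine convexHull_min ?_ hc hs
    rintro x (rfl | rfl | rfl | rfl) <;> norm_num [cons_val_two]
  · rintro ⟨h1, h2⟩
    rw [abs_le] at h1 h2
    -- Barycentric coordinates of `s`; their nonnegativity is exactly the four facet inequalities.
    let p : Fin 4 → ℝ := ![(1 + s 0 + s 1 + s 2) / 4, (1 + s 0 - s 1 - s 2) / 4,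
      (1 - s 0 + s 1 - s 2) / 4, (1 - s 0 - s 1 + s 2) / 4]
    let v : Fin 4 → Fin 3 → ℝ := ![![1, 1, 1], ![1, -1, -1], ![-1, 1, -1], ![-1, -1, 1]]
    have hs : s = ∑ i, p i • v i := by
      ext j
      fin_cases j <;> simp [Fin.sum_univ_four, p, v] <;> ring
    rw [hs]
    refine (convex_convexHull ℝ _).sum_mem (fun i _ => ?_) ?_ fun i _ => subset_convexHull ℝ _ ?_
    · fin_cases i <;> simp [p] <;> linarith
    · simp [Fin.sum_univ_four, p]; ring
    · fin_cases i <;> simp [v]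

/-- Sum and product of `z`, `w` are real, so the two are both real or conjugate. If real, `(z + w)²
= 4 (Re α)²` and `(z - w)² = 4 (|β|² - (Im α)²)`; if conjugate, `|z|² = |α|² - |β|²`. -/
theorem HasNormalForm.exists_tetrahedron {Λ : Multiset ℂ} (h : HasNormalForm Λ) :
    ∃ l : Fin 3 → ℂ, Λ = {1} + Multiset.map l Finset.univ.val ∧
      Multiset.map (fun z : ℂ => conj z) (Multiset.map l Finset.univ.val) =
        Multiset.map l Finset.univ.val ∧
      (fun i => realOrAbs (l i)) ∈ tetrahedron := by
  obtain ⟨r, α, β, z, w, hα, hβ, hs, hp, rfl⟩ := h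
  have hl : Multiset.map ![(r : ℂ), z, w] Finset.univ.val = {(r : ℂ), z, w} := rfl
  refine ⟨![r, z, w], by rw [hl]; rfl, ?_⟩
  rw [hl, mem_tetrahedron_iff]
  simp only [Multiset.insert_eq_cons, Multiset.map_cons, Multiset.map_singleton,
    Complex.conj_ofReal]
  have hr : realOrAbs r = r := by simp [realOrAbs]
  simp only [cons_val_zero, cons_val_one, cons_val_two, tail_cons, head_cons, hr]
  have hα2 : ‖α‖ ^ 2 = α.re ^ 2 + α.im ^ 2 := by rw [Complex.sq_norm, Complex.normSq_apply]; ring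
  have hβ2 : ‖β‖ ^ 2 = β.re ^ 2 + β.im ^ 2 := by rw [Complex.sq_norm, Complex.normSq_apply]; ring
  have hα0 := norm_nonneg α
  have hβ0 := norm_nonneg β
  have s1 := congrArg Complex.re hs
  have s2 := congrArg Complex.im hs
  have p1 := congrArg Complex.re hp
  have p2 := congrArg Complex.im hp
  simp at s1 s2 p1 p2
  by_cases hz : z.im = 0
  · have hw : w.im = 0 := by linarith
    rw [Complex.conj_eq_iff_im.2 hz, Complex.conj_eq_iff_im.2 hw]
    simp only [realOrAbs, hz, hw, if_true, true_and]
    rw [hz, hw] at p1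
    constructor
    · refine le_trans ?_ hα
      apply abs_le_of_sq_le_sq _ (by linarith)
      rw [s1]; nlinarith [sq_nonneg α.im]
    · refine le_trans ?_ hβ
      apply abs_le_of_sq_le_sq _ (by linarith)
      have : (z.re - w.re) ^ 2 = (z.re + w.re) ^ 2 - 4 * (z.re * w.re) := by ring
      rw [this, s1]
      nlinarith [sq_nonneg α.im]
  · have hwi : w.im = -z.im := by linarith
    have hwr : w.re = z.re := by
      have : z.im * (w.re - z.re) = 0 := by rw [hwi] at p2; linarith
      rcases mul_eq_zero.1 this with h | h
      · exact absurd h hz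
      · linarith
    have hw : w = conj z := Complex.ext (by simp [hwr]) (by simp [hwi])
    subst hw
    refine ⟨by rw [Complex.conj_conj]; exact congrArg _ (Multiset.pair_comm _ _), ?_⟩
    have hz' : -z.im ≠ 0 := by simpa using hz
    simp only [realOrAbs, Complex.conj_im, hz, hz', if_false, Complex.norm_conj]
    have hz2 : ‖z‖ ^ 2 = z.re ^ 2 + z.im ^ 2 := by
      rw [Complex.sq_norm, Complex.normSq_apply]; ring
    have hza : ‖z‖ ≤ ‖α‖ := by
      refine abs_le_of_sq_le_sq' ?_ hα0 |>.2
      rw [hwi, hwr] at p1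
      nlinarith [sq_nonneg β.re, sq_nonneg β.im]
    have := norm_nonneg z
    rw [abs_of_nonneg (by linarith), sub_self, abs_zero]
    constructor <;> linarith

theorem hasNormalForm_of_real {x y r : ℝ} (h : |x + y| ≤ 1 + r ∧ |x - y| ≤ 1 - r) :
    HasNormalForm {1, (r : ℂ), (x : ℂ), (y : ℂ)} := by
  -- For real `α`, `β` the eigenvalues of the block are `α ± β`.
  refine ⟨r, ((x + y) / 2 : ℝ), ((x - y) / 2 : ℝ), x, y, ?_, ?_, ?_, ?_, rfl⟩
  · rw [Complex.norm_real, Real.norm_eq_abs, abs_div]; norm_num; linarith [h.1]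
  · rw [Complex.norm_real, Real.norm_eq_abs, abs_div]; norm_num; linarith [h.2]
  · rw [Complex.conj_ofReal]; push_cast; ring
  · rw [Complex.conj_ofReal, Complex.conj_ofReal]; push_cast; ring

theorem hasNormalForm_of_conj {r : ℝ} {z : ℂ} (h : 2 * ‖z‖ ≤ 1 + r) (hr : r ≤ 1) :
    HasNormalForm {1, (r : ℂ), z, conj z} :=
  ⟨r, z, 0, z, conj z, h, by simpa using hr, rfl, by simp, rfl⟩

theorem hasNormalForm_of_tetrahedron {l : Fin 3 → ℂ}
    (hc : Multiset.map (fun z : ℂ => conj z) (Multiset.map l Finset.univ.val) =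
        Multiset.map l Finset.univ.val)
    (ht : (fun i => realOrAbs (l i)) ∈ tetrahedron) :
    HasNormalForm ({1} + Multiset.map l Finset.univ.val) := by
  have hl : Multiset.map l Finset.univ.val = {l 0, l 1, l 2} := rfl
  rw [mem_tetrahedron_iff] at ht
  rw [hl] at hc ⊢
  by_cases hreal : ∀ i, (l i).im = 0
  · simp only [realOrAbs, hreal, if_true] at ht
    have hre (i : Fin 3) : ((l i).re : ℂ) = l i := Complex.ext (by simp) (by simp [hreal])
    have := hasNormalForm_of_real ht
    rwa [hre, hre, hre] at this
  · push Not at hreal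
    obtain ⟨i, hi⟩ := hreal
    -- The partner `j` of a nonreal `l i` comes from conjugation invariance, and `k` is the index
    -- left over. On the plane where coordinates `i` and `j` agree, the facets give the two bounds
    -- of `hasNormalForm_of_conj`.
    obtain ⟨j, k, hj, hperm, hbound⟩ : ∃ j k, l j = conj (l i) ∧
        ({l 0, l 1, l 2} : Multiset ℂ) = {l k, l i, l j} ∧
        (realOrAbs (l j) = realOrAbs (l i) →
          2 * realOrAbs (l i) ≤ 1 + realOrAbs (l k) ∧ realOrAbs (l k) ≤ 1) := by
      have hne : l i ≠ conj (l i) := fun h => hi (Complex.conj_eq_iff_im.1 h.symm)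
      have hmem : conj (l i) ∈ ({l 0, l 1, l 2} : Multiset ℂ) := by
        rw [← hc, ← hl]
        exact Multiset.mem_map_of_mem _ (Multiset.mem_map_of_mem _ (Finset.mem_univ i))
      simp only [Multiset.insert_eq_cons, Multiset.mem_cons, Multiset.mem_singleton] at hmem
      simp only [abs_le] at ht
      have c01 (a b c : ℂ) : ({a, b, c} : Multiset ℂ) = {b, a, c} := Multiset.cons_swap a b _
      have c12 (a b c : ℂ) : ({a, b, c} : Multiset ℂ) = {a, c, b} :=
        congrArg (a ::ₘ ·) (Multiset.pair_comm b c)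
      have key (j k : Fin 3) (hj : conj (l i) = l j)
        (hperm : ({l 0, l 1, l 2} : Multiset ℂ) = {l k, l i, l j})
        (hb : realOrAbs (l j) = realOrAbs (l i) →
          2 * realOrAbs (l i) ≤ 1 + realOrAbs (l k) ∧ realOrAbs (l k) ≤ 1) := 
        (⟨j, k, hj.symm, hperm, hb⟩ : ∃ j k, l j = conj (l i) ∧
        ({l 0, l 1, l 2} : Multiset ℂ) = {l k, l i, l j} ∧
        (realOrAbs (l j) = realOrAbs (l i) →
          2 * realOrAbs (l i) ≤ 1 + realOrAbs (l k) ∧ realOrAbs (l k) ≤ 1))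
      fin_cases i <;> simp only [Fin.zero_eta, Fin.mk_one, Fin.reduceFinMk] at * <;>
        rcases hmem with h | h | h <;> first | exact absurd h.symm hne | skip
      · exact key 1 2 h (by rw [c12, c01]) (fun e => by constructor <;> linarith)
      · exact key 2 1 h (by rw [c01]) (fun e => by constructor <;> linarith)
      · exact key 0 2 h (by rw [c12, c01, c12]) (fun e => by constructor <;> linarith)
      · exact key 2 0 h rfl (fun e => by constructor <;> linarith)
      · exact key 0 1 h (by rw [c01, c12]) (fun e => by constructor <;> linarith)
      · exact key 1 0 h (by rw [c12]) (fun e => by constructor <;> linarith)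
    have hj0 : realOrAbs (l j) = realOrAbs (l i) := by simp [realOrAbs, hj, hi]
    replace hbound := hbound hj0
    simp only [realOrAbs, hi, if_false] at hbound
    -- The sum of the multiset is real, and so is `l i + l j`.
    have hk : (l k).im = 0 := by
      have := congrArg Multiset.sum hc
      rw [hperm] at this
      simp [hj] at this
      refine Complex.conj_eq_iff_im.1 ?_
      linear_combination this
    rw [if_pos hk] at hbound
    have hre : ((l k).re : ℂ) = l k := Complex.ext (by simp) (by simp [hk])
    have := hasNormalForm_of_conj hbound.1 hbound.2
    rw [hperm, hj]
    rwa [hre] at this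

/-! ### From a channel to its normal form -/

/-- Coordinates with respect to `diag(1, -1)`, `E₀₁`, `E₁₀`, `E₀₀`. -/
def adaptedEquiv : Matrix (Fin 2) (Fin 2) ℂ ≃ₗ[ℂ] (Fin 4 → ℂ) where
  toFun X := ![-X 1 1, X 0 1, X 1 0, X 0 0 + X 1 1]
  invFun v := !![v 0 + v 3, v 1; v 2, -v 0]
  map_add' X Y := by ext i; fin_cases i <;> simp <;> ring
  map_smul' c X := by ext i; fin_cases i <;> simp <;> ring
  left_inv X := by ext i j; fin_cases i <;> fin_cases j <;> simp
  right_inv v := by ext i; fin_cases i <;> simp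

/-- The basis `diag(1, -1)`, `E₀₁`, `E₁₀`, `E₀₀`. -/
noncomputable def adaptedBasis : Module.Basis (Fin 4) ℂ (Matrix (Fin 2) (Fin 2) ℂ) :=
  .ofEquivFun adaptedEquiv

theorem adaptedBasis_repr (X : Matrix (Fin 2) (Fin 2) ℂ) (i : Fin 4) :
    adaptedBasis.repr X i = ![-X 1 1, X 0 1, X 1 0, X 0 0 + X 1 1] i := rfl

theorem adaptedBasis_apply (i : Fin 4) : adaptedBasis i =
    ![!![1, 0; 0, -1], single 0 1 1, single 1 0 1, single 0 0 1] i := by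
  rw [adaptedBasis, Module.Basis.coe_ofEquivFun]
  ext j k
  fin_cases i <;> fin_cases j <;> fin_cases k <;> simp [adaptedEquiv]

variable {T : Matrix (Fin 2) (Fin 2) ℂ →ₗ[ℂ] Matrix (Fin 2) (Fin 2) ℂ}

/-- The images of the first three basis vectors are traceless, so only `E₀₀` contributes to the last
row, and the matrix is block upper triangular with blocks of size 1, 2, 1. -/
theorem charpoly_of_apply_adaptedBasis {r x y α β γ δ p u v : ℂ}
    (hZ : T !![1, 0; 0, -1] = r • !![1, 0; 0, -1])
    (h01 : T (single 0 1 1) = !![x, α; β, -x])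
    (h10 : T (single 1 0 1) = !![y, δ; γ, -y])
    (h00 : T (single 0 0 1) = !![p, u; v, 1 - p]) :
    T.charpoly = (X - C 1) * (X - C r) * (X ^ 2 - C (α + γ) * X + C (α * γ - β * δ)) := by
  have hM : LinearMap.toMatrix adaptedBasis adaptedBasis T =
      !![r, x, y, p - 1; 0, α, δ, u; 0, β, γ, v; 0, 0, 0, 1] := by
    ext i j
    rw [LinearMap.toMatrix_apply, adaptedBasis_repr, adaptedBasis_apply]
    fin_cases i <;> fin_cases j <;> simp [hZ, h01, h10, h00]
  rw [← LinearMap.charpoly_toMatrix T adaptedBasis, hM, Matrix.charpoly]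
  simp [det_succ_row_zero, Fin.sum_univ_succ, charmatrix_apply, Matrix.diagonal_apply,
    Fin.succAbove]
  ring

theorem spec_of_charpoly {r s t z w : ℂ}
    (hT : T.charpoly = (X - C 1) * (X - C r) * (X ^ 2 - C s * X + C t))
    (hs : z + w = s) (ht : z * w = t) : spec T = {1, r, z, w} := by
  have : T.charpoly = (({1, r, z, w} : Multiset ℂ).map fun a => X - C a).prod := by
    rw [hT, ← hs, ← ht]
    simp
    ring
  rw [spec, this, roots_multiset_prod_X_sub_C]

theorem exists_add_eq_mul_eq (s t : ℂ) : ∃ z w : ℂ, z + w = s ∧ z * w = t := by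
  obtain ⟨d, hd⟩ := IsAlgClosed.exists_pow_nat_eq (s ^ 2 - 4 * t) (n := 2) (by norm_num)
  exact ⟨(s + d) / 2, (s - d) / 2, by ring, by linear_combination -hd / 4⟩

theorem IsQuantumChannel.hasNormalForm_of_eigenvector (hT : IsQuantumChannel T) {r : ℝ}
    (hZ : T !![1, 0; 0, -1] = (r : ℂ) • !![1, 0; 0, -1]) : HasNormalForm (spec T) := by
  have htr (i j : Fin 2) := hT.2 (single i j 1)
  simp only [trace_fin_two] at htr
  have hstar := hT.1.star_apply_single
  have hZ' : T (single 1 1 1) = T (single 0 0 1) - (r : ℂ) • !![1, 0; 0, -1] := by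
    rw [← hZ, ← map_sub]
    congr 1
    ext i j
    fin_cases i <;> fin_cases j <;> simp
  have hminor (a b : Fin 2 × Fin 2) := two_mul_norm_le_of_posSemidef
    (hT.1.choi_posSemidef.submatrix ![a, b])
  -- These two minors have `α` and `β` off the diagonal. Trace preservation and `hZ'` make their
  -- diagonal sums `1 + r` and `1 - r`.
  have hα := hminor (0, 0) (1, 1)
  have hβ := hminor (1, 0) (0, 1)
  simp only [submatrix_apply, of_apply, cons_val_zero, cons_val_one] at hα hβ
  have h00 := htr 0 0
  have h01 := htr 0 1
  have h10 := htr 1 0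
  simp at h00 h01 h10
  have h00re := congrArg Complex.re h00
  simp at h00re
  rw [hZ'] at hα hβ
  simp at hα hβ
  obtain ⟨z, w, hs, ht⟩ := exists_add_eq_mul_eq
    (T (single 0 1 1) 0 1 + conj (T (single 0 1 1) 0 1))
    (T (single 0 1 1) 0 1 * conj (T (single 0 1 1) 0 1) -
      T (single 0 1 1) 1 0 * conj (T (single 0 1 1) 1 0))
  refine ⟨r, T (single 0 1 1) 0 1, T (single 0 1 1) 1 0, z, w, by linarith, by linarith, hs, ht,
    spec_of_charpoly (charpoly_of_apply_adaptedBasis (x := T (single 0 1 1) 0 0)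
      (y := T (single 1 0 1) 0 0) (p := T (single 0 0 1) 0 0) (u := T (single 0 0 1) 0 1)
      (v := T (single 0 0 1) 1 0) hZ ?_ ?_ ?_) hs ht⟩ <;>
  · ext i j
    fin_cases i <;> fin_cases j <;> simp [hstar] <;> grind

/-- Conjugation by a unitary matrix. -/
def conjEquiv {n : Type*} [Fintype n] [DecidableEq n] {U : Matrix n n ℂ} (hU : Uᴴ * U = 1)
    (hU' : U * Uᴴ = 1) : Matrix n n ℂ ≃ₗ[ℂ] Matrix n n ℂ where
  __ := conjMap U
  invFun := conjMap Uᴴ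
  left_inv X := by
    change Uᴴ * (U * X * Uᴴ) * Uᴴᴴ = X
    rw [conjTranspose_conjTranspose, ← mul_assoc, ← mul_assoc, hU, one_mul, mul_assoc, hU, mul_one]
  right_inv X := by
    change U * (Uᴴ * X * Uᴴᴴ) * Uᴴ = X
    rw [conjTranspose_conjTranspose, ← mul_assoc, ← mul_assoc, hU', one_mul, mul_assoc, hU',
      mul_one]

theorem spec_conjMap_comp_comp {U : Matrix (Fin 2) (Fin 2) ℂ} (hU : Uᴴ * U = 1)
    (hU' : U * Uᴴ = 1) : spec (conjMap Uᴴ ∘ₗ T ∘ₗ conjMap U) = spec T :=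
  congrArg Polynomial.roots ((conjEquiv hU hU').symm.charpoly_conj T)

theorem IsQuantumChannel.conjMap_comp_comp (hT : IsQuantumChannel T)
    {U : Matrix (Fin 2) (Fin 2) ℂ} (hU : Uᴴ * U = 1) (hU' : U * Uᴴ = 1) :
    IsQuantumChannel (conjMap Uᴴ ∘ₗ T ∘ₗ conjMap U) := by
  refine ⟨(isCompletelyPositive_conjMap Uᴴ).comp (hT.1.comp (isCompletelyPositive_conjMap U)),
    fun X => ?_⟩
  simp only [LinearMap.comp_apply, conjMap_apply, conjTranspose_conjTranspose]
  rw [trace_mul_cycle, hU', one_mul, hT.2, trace_mul_cycle, hU, one_mul]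

theorem IsQuantumChannel.hasNormalForm (hT : IsQuantumChannel T) : HasNormalForm (spec T) := by
  obtain ⟨r, H, hH, h0, hne, hTH⟩ := exists_traceless_eigenvector hT
  obtain ⟨U, c, hU, hU', rfl⟩ := exists_unitary_diagonalization hH h0
  have hc : c ≠ 0 := by
    rintro rfl
    simp at hne
  rw [← spec_conjMap_comp_comp hU hU']
  refine (hT.conjMap_comp_comp hU hU').hasNormalForm_of_eigenvector (r := r) ?_
  generalize (!![1, 0; 0, -1] : Matrix (Fin 2) (Fin 2) ℂ) = Z at *
  have h1 : T (U * Z * Uᴴ) = (r : ℂ) • (U * Z * Uᴴ) := by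
    rw [Matrix.mul_smul, Matrix.smul_mul, map_smul, smul_comm] at hTH
    exact smul_right_injective _ hc hTH
  simp only [LinearMap.comp_apply, conjMap_apply, conjTranspose_conjTranspose]
  rw [h1, Matrix.mul_smul, Matrix.smul_mul, ← mul_assoc, ← mul_assoc, hU, one_mul, mul_assoc, hU,
    mul_one]

/-! ### Realising a normal form by a unital channel -/

/-- The unital channel with the spectrum `{1, r, z, w}`, where `z`, `w` are the eigenvalues of
`!![α, β; β̄, ᾱ]`. -/
noncomputable def normalFormMap (r : ℝ) (α β : ℂ) :
    Matrix (Fin 2) (Fin 2) ℂ →ₗ[ℂ] Matrix (Fin 2) (Fin 2) ℂ where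
  toFun X := !![(1 + r) / 2 * X 0 0 + (1 - r) / 2 * X 1 1, α * X 0 1 + conj β * X 1 0;
    β * X 0 1 + conj α * X 1 0, (1 - r) / 2 * X 0 0 + (1 + r) / 2 * X 1 1]
  map_add' X Y := by ext i j; fin_cases i <;> fin_cases j <;> simp <;> ring
  map_smul' c X := by ext i j; fin_cases i <;> fin_cases j <;> simp <;> ring

theorem normalFormMap_apply (r : ℝ) (α β : ℂ) (X : Matrix (Fin 2) (Fin 2) ℂ) :
    normalFormMap r α β X =
      !![(1 + r) / 2 * X 0 0 + (1 - r) / 2 * X 1 1, α * X 0 1 + conj β * X 1 0;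
        β * X 0 1 + conj α * X 1 0, (1 - r) / 2 * X 0 0 + (1 + r) / 2 * X 1 1] := rfl

/-- Cholesky factors of `!![s, a; ā, s]`. -/
theorem exists_cholesky {s : ℝ} {a : ℂ} (h : ‖a‖ ≤ s) :
    ∃ x y z : ℂ, x * conj x = s ∧ x * conj y = a ∧ y * conj y + z * conj z = s := by
  rcases (norm_nonneg a |>.trans h).eq_or_lt with rfl | hs
  · exact ⟨0, 0, 0, by simp, by simpa using (norm_le_zero_iff.1 h).symm, by simp⟩
  · have h2 : ‖a‖ ^ 2 / s ≤ s := by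
      rw [div_le_iff₀ hs, ← sq]
      gcongr
    have hsq : (√s : ℂ) * √s = s := by exact_mod_cast Real.mul_self_sqrt hs.le
    have hs0 : (s : ℂ) ≠ 0 := by exact_mod_cast hs.ne'
    have hne : (√s : ℂ) ≠ 0 := by exact_mod_cast (Real.sqrt_pos.2 hs).ne'
    have hz : (√(s - ‖a‖ ^ 2 / s) : ℂ) * √(s - ‖a‖ ^ 2 / s) = s - a * conj a / s := by
      rw [Complex.mul_conj']
      exact_mod_cast Real.mul_self_sqrt (sub_nonneg.2 h2)
    -- The last entry is the square root of the Schur complement.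
    refine ⟨√s, conj a / √s, √(s - ‖a‖ ^ 2 / s), ?_, ?_, ?_⟩
    · rw [Complex.conj_ofReal, hsq]
    · simp only [map_div₀, Complex.conj_conj, Complex.conj_ofReal]
      field_simp
    · simp only [map_div₀, Complex.conj_conj, Complex.conj_ofReal]
      rw [hz, div_mul_div_comm, hsq]
      ring

theorem isQuantumChannel_normalFormMap {r : ℝ} {α β : ℂ} (hα : 2 * ‖α‖ ≤ 1 + r)
    (hβ : 2 * ‖β‖ ≤ 1 - r) : IsQuantumChannel (normalFormMap r α β) := by
  constructor
  · obtain ⟨a, b, c, haa, hab, hbc⟩ := exists_cholesky (s := (1 + r) / 2) (a := α) (by linarith)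
    obtain ⟨d, e, f, hdd, hde, hef⟩ := exists_cholesky (s := (1 - r) / 2) (a := β) (by linarith)
    have hab' := congrArg conj hab
    have hde' := congrArg conj hde
    simp only [map_mul, Complex.conj_conj] at hab' hde'
    push_cast at haa hbc hdd hef
    -- The Choi matrix splits into two 2×2 blocks, with off-diagonal entries `α` and `β`; the
    -- columns of their Cholesky factors are the Kraus operators.
    have h : normalFormMap r α β = conjMap !![a, 0; 0, b] + conjMap !![0, 0; 0, c] +
        conjMap !![0, e; d, 0] + conjMap !![0, f; 0, 0] := by
      ext1 X
      ext i j
      rw [normalFormMap_apply]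
      simp only [LinearMap.add_apply, Matrix.add_apply, conjMap_apply, Matrix.mul_apply,
        Fin.sum_univ_two, conjTranspose_apply]
      fin_cases i <;> fin_cases j <;> simp
      · linear_combination - X 0 0 * haa - X 1 1 * hef
      · linear_combination - X 0 1 * hab - X 1 0 * hde'
      · linear_combination - X 0 1 * hde - X 1 0 * hab'
      · linear_combination - X 0 0 * hdd - X 1 1 * hbc
    rw [h]
    exact (((isCompletelyPositive_conjMap _).add (isCompletelyPositive_conjMap _)).add
      (isCompletelyPositive_conjMap _)).add (isCompletelyPositive_conjMap _)
  · intro X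
    simp [normalFormMap_apply, trace_fin_two]
    ring

theorem isUnital_normalFormMap (r : ℝ) (α β : ℂ) : IsUnital (normalFormMap r α β) := by
  ext i j
  fin_cases i <;> fin_cases j <;> simp [normalFormMap_apply] <;> ring

theorem spec_normalFormMap (r : ℝ) {α β z w : ℂ} (hs : z + w = α + conj α)
    (ht : z * w = α * conj α - β * conj β) : spec (normalFormMap r α β) = {1, (r : ℂ), z, w} := by
  refine spec_of_charpoly (charpoly_of_apply_adaptedBasis (x := 0) (y := 0) (p := (1 + r) / 2)
    (u := 0) (v := 0) ?_ ?_ ?_ ?_) hs ht <;>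
  · ext i j
    fin_cases i <;> fin_cases j <;> simp [normalFormMap_apply] <;> ring

theorem HasNormalForm.exists_unital_channel {Λ : Multiset ℂ} (h : HasNormalForm Λ) :
    ∃ T : Matrix (Fin 2) (Fin 2) ℂ →ₗ[ℂ] Matrix (Fin 2) (Fin 2) ℂ,
      IsQuantumChannel T ∧ IsUnital T ∧ spec T = Λ := by
  obtain ⟨r, α, β, z, w, hα, hβ, hs, ht, rfl⟩ := h
  exact ⟨normalFormMap r α β, isQuantumChannel_normalFormMap hα hβ, isUnital_normalFormMap r α β,
    spec_normalFormMap r hs ht⟩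

end QubitSpectrum

theorem theorem1 (Λ : Multiset ℂ) (hΛ : Multiset.card Λ = 4) :
    List.TFAE [
      ∃ T : Matrix (Fin 2) (Fin 2) ℂ →ₗ[ℂ] Matrix (Fin 2) (Fin 2) ℂ,
        QubitSpectrum.IsQuantumChannel T ∧ QubitSpectrum.spec T = Λ,
      ∃ T : Matrix (Fin 2) (Fin 2) ℂ →ₗ[ℂ] Matrix (Fin 2) (Fin 2) ℂ,
        QubitSpectrum.IsQuantumChannel T ∧ QubitSpectrum.IsUnital T ∧ QubitSpectrum.spec T = Λ,
      ∃ l : Fin 3 → ℂ,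
        Λ = {1} + Multiset.map l Finset.univ.val ∧
        Multiset.map (fun z : ℂ => conj z) (Multiset.map l Finset.univ.val) =
          Multiset.map l Finset.univ.val ∧
        (fun i => QubitSpectrum.realOrAbs (l i)) ∈ QubitSpectrum.tetrahedron] := by
  tfae_have 2 → 1 := fun ⟨T, hT, _, h⟩ => ⟨T, hT, h⟩
  tfae_have 1 → 3 := by
    rintro ⟨T, hT, rfl⟩
    exact hT.hasNormalForm.exists_tetrahedron
  tfae_have 3 → 2 := by
    rintro ⟨l, rfl, hc, ht⟩
    exact (QubitSpectrum.hasNormalForm_of_tetrahedron hc ht).exists_unital_channel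
  tfae_finish
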